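/- \textbf{Process graphs and processes.} Fix a set $\mathit{Act}$ of actions and a silent action $\tau\notin \mathit{Act}$; for $\mathcal A\subseteq \mathit{Act}$ write $\mathcal A_\tau=\mathcal A\cup\{\tau\}$. A \emph{process graph} $(\mathcal S,\mathcal A,\to,\uparrow,\downarrow)$ consists of a set $\mathcal S$ of states, a set $\mathcal A\subseteq \mathit{Act}$, a relation $\to\,\subseteq\mathcal S\times\mathcal A_\tau\times\mathcal S$, an initial state $\uparrow\,\in\mathcal S$ and a set $\downarrow\,\subseteq\mathcal S$ of final states. Write $s\xrightarrow{a}t$ for $(s,a,t)\in\,\to$ and $s{\downarrow}$ for $s\in\,\downarrow$. For $w\in \mathit{Act}^*$ write $s\twoheadrightarrow^{w}t$ if there is a path from $s$ to $t$ whose labels, with all $\tau$'s deleted, spell $w$; write $s\xrightarrow{(a)}t$ if $s\xrightarrow{a}t$, or $a=\tau$ and $s=t$. The \emph{language} of a process graph is $\{w \mid \exists s:\ \uparrow\,\twoheadrightarrow^{w}s \text{ and } s{\downarrow}\}$. A symmetric relation $R$ on the states is a \emph{branching bisimulation} if $s\mathrel R t$ implies: (i) whenever $s\xrightarrow{a}s'$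 with $a\in\mathcal A_\tau$, there are $t',t''$ with $t\twoheadrightarrow^{\varepsilon}t''\xrightarrow{(a)}t'$, $s\mathrel R t''$ and $s'\mathrel R t'$; (ii) if $s{\downarrow}$, then $t\twoheadrightarrow^{\varepsilon}t'$ for some $t'$ with $t'{\downarrow}$. Two process graphs are \emph{branching bisimilar} if a branching bisimulation on their disjoint union relates their initial states. This is an equivalence relation; a \emph{process} is an equivalence class of process graphs. \textbf{Queue automata.} A \emph{queue automaton} $(\mathcal S,\mathcal A,\mathcal D,\to,\uparrow,\downarrow)$ consists of nonempty finite sets $\mathcal S$ (states), $\mathcal A\subseteq \mathit{Act}$ and $\mathcal D$ (data), a finite set $\to\,\subseteq\mathcal S\times\mathcal A_\tau\times(\mathcal D\cup\{\varepsilon,*\})\times\mathcal D^*\times\mathcal S$ of transitions $s\xrightarrow{a[x/\delta]}t$, an initial state $\uparrow\,\in\mathcal S$ and a set $\downarrow\,\subseteq\mathcal S$ of final states. Its process graph has state set $\mathcal S\times\mathcal D^*$, action set $\mathcal A$, initial state $(\uparrow,\varepsilon)$, final states the $(s,\delta)$ with $s{\downarrow}$, and exactly the following transitions, for $\zeta\in\mathcal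 D^*$ and $d\in\mathcal D$: $(s,\varepsilon)\xrightarrow{a}(t,\delta)$ if $s\xrightarrow{a[\varepsilon/\delta]}t$; $(s,\zeta d)\xrightarrow{a}(t,\delta\zeta)$ if $s\xrightarrow{a[d/\delta]}t$; $(s,\zeta)\xrightarrow{a}(t,\delta\zeta)$ if $s\xrightarrow{a[*/\delta]}t$. The \emph{process} of the automaton is the equivalence class of its process graph, and the \emph{language accepted} by it is the language of its process graph. \textbf{Reactive Turing machines.} A \emph{reactive Turing machine} (RTM) $(\mathcal S,\mathcal A,\mathcal D,\to,\uparrow,\downarrow)$ is given by the same data, except that $\to$ is a finite subset of $\mathcal S\times\mathcal A_\tau\times\mathcal D_\Box\times\mathcal D_\Box\times\{L,R\}\times\mathcal S$, where $\mathcal D_\Box=\mathcal D\cup\{\Box\}$ and $\Box\notin\mathcal D$ is the blank. The states of its process graph are the pairs of a state in $\mathcal S$ and a two-way infinite tape over $\mathcal D_\Box$ with finitely many non-blank cells and a marked head cell (tapes taken relative to the head). It has a transition labelled $a$ from $(s,T)$ to $(t,T')$ iff for some $(s,a,d,e,m,t)\in\,\to$ the symbol under the head of $T$ is $d$ and $T'$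 arises from $T$ by replacing this symbol by $e$ and then moving the head one cell to the left ($m=L$) or right ($m=R$). Its action set is $\mathcal A$, its initial state is $\uparrow$ with the blank tape, and its final states are the pairs $(s,T)$ with $s{\downarrow}$. A process is \emph{executable} if it contains the process graph of some RTM. A language is \emph{computable} if it is the language of the process graph of some RTM. \textbf{Corollary.} A process is executable if and only if it is the process of a queue automaton. A language $L\subseteq\mathit{Act}^*$ is computable if and only if it is the language accepted by a queue automaton. -/

import Mathlib

universe u v

namespace QueueAutomata

/-- A labelled transition system with actions drawn from the type `Act`. Labels are elements of
`Option Act`, where `none` is the silent action `τ` and `some a` is the observable action `a`. -/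
structure LTS (Act : Type u) where
  State : Type v
  actions : Set Act
  Step : State → Option Act → State → Prop
  step_mem : ∀ s a t, Step s (some a) t → a ∈ actions
  Final : Set State

namespace LTS

variable {Act : Type u}

/-- `T.Steps s w t` : the state `t` is reached from `s` by a path whose sequence of observable
actions is `w` (silent steps do not contribute to `w`). -/
inductive Steps (T : LTS.{u, v} Act) : T.State → List Act → T.State → Prop
  | refl (s : T.State) : Steps T s [] s
  | act {s t r : T.State} {a : Act} {w : List Act} :
      T.Step s (some a) t → Steps T t w r → Steps T s (a :: w) r
  | tau {s t r : T.State} {w : List Act} :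
      T.Step s none t → Steps T t w r → Steps T s w r

/-- The optional step `s —(a)→ t`: either `s —a→ t`, or `a = τ` and `s = t`. -/
def OptStep (T : LTS.{u, v} Act) (s : T.State) (a : Option Act) (t : T.State) : Prop :=
  T.Step s a t ∨ (a = none ∧ s = t)

/-- Branching bisimulations on a labelled transition system. -/
structure IsBranchingBisimulation (T : LTS.{u, v} Act) (R : T.State → T.State → Prop) : Prop where
  symm : ∀ s t, R s t → R t s
  step : ∀ s t, R s t → ∀ a s', T.Step s a s' →
    ∃ t' t'', T.Steps t [] t'' ∧ T.OptStep t'' a t' ∧ R s t'' ∧ R s' t'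
  final : ∀ s t, R s t → s ∈ T.Final → ∃ t', T.Steps t [] t' ∧ t' ∈ T.Final

/-- Branching bisimilarity of two states of a labelled transition system. -/
def BranchingBisimilar (T : LTS.{u, v} Act) (s t : T.State) : Prop :=
  ∃ R : T.State → T.State → Prop, T.IsBranchingBisimulation R ∧ R s t

/-- The disjoint union of two labelled transition systems. -/
def sum (T U : LTS.{u, v} Act) : LTS.{u, v} Act where
  State := T.State ⊕ U.State
  actions := T.actions ∪ U.actions
  Step
    | Sum.inl s, a, Sum.inl t => T.Step s a t
    | Sum.inr s, a, Sum.inr t => U.Step s a t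
    | _, _, _ => False
  step_mem := by
    rintro (s | s) a (t | t) h
    · exact Or.inl (T.step_mem s a t h)
    · exact h.elim
    · exact h.elim
    · exact Or.inr (U.step_mem s a t h)
  Final := {x | Sum.elim (fun s => s ∈ T.Final) (fun t => t ∈ U.Final) x}

end LTS

/-- A process graph: a labelled transition system with a root state. -/
structure ProcessGraph (Act : Type u) extends LTS.{u, v} Act where
  root : State

namespace ProcessGraph

variable {Act : Type u}

/-- Two process graphs are branching bisimilar if their roots are branching bisimilar in the
disjoint union of the two underlying transition systems. -/
def BranchingBisimilar (G H : ProcessGraph.{u, v} Act) : Prop :=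
  (G.toLTS.sum H.toLTS).BranchingBisimilar (Sum.inl G.root) (Sum.inr H.root)

/-- The language of a process graph: the words along paths from the root to a final state. -/
def language (G : ProcessGraph.{u, v} Act) : Language Act :=
  {w | ∃ s, s ∈ G.Final ∧ G.Steps G.root w s}

end ProcessGraph

/-! Branching bisimilarity of process graphs is an equivalence relation. -/

namespace LTS

variable {Act : Type u}

/-- One direction of the transfer conditions, for a relation between two systems. -/
structure Transfer (T U : LTS.{u, v} Act) (R : T.State → U.State → Prop) : Prop where
  step : ∀ s t, R s t → ∀ a s', T.Step s a s' →
    ∃ t' t'', U.Steps t [] t'' ∧ U.OptStep t'' a t' ∧ R s t'' ∧ R s' t'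
  final : ∀ s t, R s t → s ∈ T.Final → ∃ t', U.Steps t [] t' ∧ t' ∈ U.Final

theorem Steps.trans {T : LTS.{u, v} Act} {s t r : T.State} {w w' : List Act}
    (h : T.Steps s w t) (h' : T.Steps t w' r) : T.Steps s (w ++ w') r := by
  induction h with
  | refl => simpa using h'
  | act h1 _ ih => exact .act h1 (ih h')
  | tau h1 _ ih => exact .tau h1 (ih h')

theorem Steps.sum_inl {T U : LTS.{u, v} Act} {s t : T.State} {w : List Act}
    (h : T.Steps s w t) : (T.sum U).Steps (Sum.inl s) w (Sum.inl t) := by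
  induction h with
  | refl => exact .refl _
  | @act s t r a w h1 _ ih => exact Steps.act (T := T.sum U) (t := Sum.inl t) h1 ih
  | @tau s t r w h1 _ ih => exact Steps.tau (T := T.sum U) (t := Sum.inl t) h1 ih

theorem Steps.sum_inr {T U : LTS.{u, v} Act} {s t : U.State} {w : List Act}
    (h : U.Steps s w t) : (T.sum U).Steps (Sum.inr s) w (Sum.inr t) := by
  induction h with
  | refl => exact .refl _
  | @act s t r a w h1 _ ih => exact Steps.act (T := T.sum U) (t := Sum.inr t) h1 ih
  | @tau s t r w h1 _ ih => exact Steps.tau (T := T.sum U) (t := Sum.inr t) h1 ih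

theorem Steps.of_sum {T U : LTS.{u, v} Act} {x y : (T.sum U).State} {w : List Act}
    (h : (T.sum U).Steps x w y) :
    (∀ s, x = Sum.inl s → ∃ t, y = Sum.inl t ∧ T.Steps s w t) ∧
    (∀ s, x = Sum.inr s → ∃ t, y = Sum.inr t ∧ U.Steps s w t) := by
  induction h with
  | refl x => exact ⟨fun s h => ⟨s, h, .refl _⟩, fun s h => ⟨s, h, .refl _⟩⟩
  | @act x y z a w h1 _ ih =>
    constructor
    · rintro s rfl
      rcases y with y | y
      · obtain ⟨t, ht, hs⟩ := ih.1 y rfl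
        exact ⟨t, ht, .act h1 hs⟩
      · exact h1.elim
    · rintro s rfl
      rcases y with y | y
      · exact h1.elim
      · obtain ⟨t, ht, hs⟩ := ih.2 y rfl
        exact ⟨t, ht, .act h1 hs⟩
  | @tau x y z w h1 _ ih =>
    constructor
    · rintro s rfl
      rcases y with y | y
      · obtain ⟨t, ht, hs⟩ := ih.1 y rfl
        exact ⟨t, ht, .tau h1 hs⟩
      · exact h1.elim
    · rintro s rfl
      rcases y with y | y
      · exact h1.elim
      · obtain ⟨t, ht, hs⟩ := ih.2 y rfl
        exact ⟨t, ht, .tau h1 hs⟩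

theorem inl_mem_final {T U : LTS.{u, v} Act} {s : T.State} :
    (Sum.inl s : T.State ⊕ U.State) ∈ (T.sum U).Final ↔ s ∈ T.Final :=
  Iff.rfl

theorem inr_mem_final {T U : LTS.{u, v} Act} {s : U.State} :
    (Sum.inr s : T.State ⊕ U.State) ∈ (T.sum U).Final ↔ s ∈ U.Final :=
  Iff.rfl

theorem Transfer.steps {T U : LTS.{u, v} Act} {R : T.State → U.State → Prop}
    (hR : T.Transfer U R) {s s' : T.State} {w : List Act} (h : T.Steps s w s') :
    w = [] → ∀ t, R s t → ∃ t', U.Steps t [] t' ∧ R s' t' := by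
  induction h with
  | refl s => exact fun _ t ht => ⟨t, .refl _, ht⟩
  | act _ _ _ => intro h; cases h
  | @tau s r _ w h1 _ ih =>
    intro hw t ht
    obtain ⟨t', t'', h2, h3, -, h5⟩ := hR.step _ _ ht _ _ h1
    obtain ⟨q, hq, hq'⟩ := ih hw _ h5
    refine ⟨q, ?_, hq'⟩
    rcases h3 with h3 | ⟨-, rfl⟩
    · exact h2.trans (.tau h3 hq)
    · exact h2.trans hq

theorem Transfer.comp {T U V : LTS.{u, v} Act} {R : T.State → U.State → Prop}
    {S : U.State → V.State → Prop} (hR : T.Transfer U R) (hS : U.Transfer V S) :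
    T.Transfer V (fun x z => ∃ y, R x y ∧ S y z) where
  step := by
    rintro s q ⟨t, h1, h2⟩ a s' h
    obtain ⟨t', t'', h3, h4, h5, h6⟩ := hR.step _ _ h1 _ _ h
    obtain ⟨q1, h7, h8⟩ := hS.steps h3 rfl _ h2
    rcases h4 with h4 | ⟨rfl, rfl⟩
    · obtain ⟨q', q'', h9, h10, h11, h12⟩ := hS.step _ _ h8 _ _ h4
      exact ⟨q', q'', h7.trans h9, h10, ⟨_, h5, h11⟩, ⟨_, h6, h12⟩⟩
    · exact ⟨q1, q1, h7, Or.inr ⟨rfl, rfl⟩, ⟨_, h5, h8⟩, ⟨_, h6, h8⟩⟩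
  final := by
    rintro s q ⟨t, h1, h2⟩ h
    obtain ⟨t', h3, h4⟩ := hR.final _ _ h1 h
    obtain ⟨q1, h7, h8⟩ := hS.steps h3 rfl _ h2
    obtain ⟨q2, h9, h10⟩ := hS.final _ _ h8 h4
    exact ⟨q2, h7.trans h9, h10⟩

end LTS

namespace ProcessGraph

variable {Act : Type u}

/-- Branching bisimilarity of process graphs, in terms of relations between the state sets. -/
theorem branchingBisimilar_iff {G H : ProcessGraph.{u, v} Act} :
    G.BranchingBisimilar H ↔ ∃ R : G.State → H.State → Prop,
      G.toLTS.Transfer H.toLTS R ∧ H.toLTS.Transfer G.toLTS (fun t s => R s t) ∧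
      R G.root H.root := by
  constructor
  · rintro ⟨R, hR, h0⟩
    refine ⟨fun s t => R (Sum.inl s) (Sum.inr t), ⟨?_, ?_⟩, ⟨?_, ?_⟩, h0⟩
    · intro s t h a s' hs
      obtain ⟨y', y'', h1, h2, h3, h4⟩ := hR.step _ _ h a (Sum.inl s') hs
      obtain ⟨t'', rfl, h1'⟩ := h1.of_sum.2 _ rfl
      rcases h2 with h2 | ⟨rfl, rfl⟩
      · rcases y' with y' | t'
        · exact h2.elim
        · exact ⟨t', t'', h1', Or.inl h2, h3, h4⟩
      · exact ⟨t'', t'', h1', Or.inr ⟨rfl, rfl⟩, h3, h4⟩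
    · intro s t h hs
      obtain ⟨y', h1, h2⟩ := hR.final _ _ h (LTS.inl_mem_final.2 hs)
      obtain ⟨t', rfl, h1'⟩ := h1.of_sum.2 _ rfl
      exact ⟨t', h1', LTS.inr_mem_final.1 h2⟩
    · intro s t h a s' hs
      obtain ⟨y', y'', h1, h2, h3, h4⟩ := hR.step _ _ (hR.symm _ _ h) a (Sum.inr s') hs
      obtain ⟨t'', rfl, h1'⟩ := h1.of_sum.1 _ rfl
      rcases h2 with h2 | ⟨rfl, rfl⟩
      · rcases y' with t' | y'
        · exact ⟨t', t'', h1', Or.inl h2, hR.symm _ _ h3, hR.symm _ _ h4⟩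
        · exact h2.elim
      · exact ⟨t'', t'', h1', Or.inr ⟨rfl, rfl⟩, hR.symm _ _ h3, hR.symm _ _ h4⟩
    · intro s t h hs
      obtain ⟨y', h1, h2⟩ := hR.final _ _ (hR.symm _ _ h) (LTS.inr_mem_final.2 hs)
      obtain ⟨t', rfl, h1'⟩ := h1.of_sum.1 _ rfl
      exact ⟨t', h1', LTS.inl_mem_final.1 h2⟩
  · rintro ⟨R, h1, h2, h0⟩
    refine ⟨fun x y => (∃ s t, x = Sum.inl s ∧ y = Sum.inr t ∧ R s t) ∨
      (∃ s t, x = Sum.inr t ∧ y = Sum.inl s ∧ R s t), ⟨?_, ?_, ?_⟩, Or.inl ⟨_, _, rfl, rfl, h0⟩⟩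
    · rintro x y (⟨s, t, rfl, rfl, h⟩ | ⟨s, t, rfl, rfl, h⟩)
      · exact Or.inr ⟨s, t, rfl, rfl, h⟩
      · exact Or.inl ⟨s, t, rfl, rfl, h⟩
    · rintro x y (⟨s, t, rfl, rfl, h⟩ | ⟨s, t, rfl, rfl, h⟩) a x' hx
      · rcases x' with s' | x'
        · obtain ⟨t', t'', h3, h4, h5, h6⟩ := h1.step _ _ h a s' hx
          refine ⟨Sum.inr t', Sum.inr t'', h3.sum_inr, ?_, Or.inl ⟨_, _, rfl, rfl, h5⟩,
            Or.inl ⟨_, _, rfl, rfl, h6⟩⟩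
          rcases h4 with h4 | ⟨rfl, rfl⟩
          · exact Or.inl h4
          · exact Or.inr ⟨rfl, rfl⟩
        · exact hx.elim
      · rcases x' with x' | s'
        · exact hx.elim
        · obtain ⟨t', t'', h3, h4, h5, h6⟩ := h2.step _ _ h a s' hx
          refine ⟨Sum.inl t', Sum.inl t'', h3.sum_inl, ?_, Or.inr ⟨_, _, rfl, rfl, h5⟩,
            Or.inr ⟨_, _, rfl, rfl, h6⟩⟩
          rcases h4 with h4 | ⟨rfl, rfl⟩
          · exact Or.inl h4
          · exact Or.inr ⟨rfl, rfl⟩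
    · rintro x y (⟨s, t, rfl, rfl, h⟩ | ⟨s, t, rfl, rfl, h⟩) hx
      · obtain ⟨t', h3, h4⟩ := h1.final _ _ h (LTS.inl_mem_final.1 hx)
        exact ⟨Sum.inr t', h3.sum_inr, LTS.inr_mem_final.2 h4⟩
      · obtain ⟨t', h3, h4⟩ := h2.final _ _ h (LTS.inr_mem_final.1 hx)
        exact ⟨Sum.inl t', h3.sum_inl, LTS.inl_mem_final.2 h4⟩

theorem branchingBisimilar_equivalence :
    Equivalence (BranchingBisimilar (Act := Act) : ProcessGraph.{u, v} Act → _ → Prop) where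
  refl G := by
    refine branchingBisimilar_iff.2 ⟨Eq, ⟨?_, ?_⟩, ⟨?_, ?_⟩, rfl⟩
    · rintro s _ rfl a s' h
      exact ⟨s', s, .refl _, Or.inl h, rfl, rfl⟩
    · rintro s _ rfl h
      exact ⟨s, .refl _, h⟩
    · rintro s _ rfl a s' h
      exact ⟨s', _, .refl _, Or.inl h, rfl, rfl⟩
    · rintro s _ rfl h
      exact ⟨_, .refl _, h⟩
  symm := by
    intro G H h
    obtain ⟨R, h1, h2, h0⟩ := branchingBisimilar_iff.1 h
    exact branchingBisimilar_iff.2 ⟨fun t s => R s t, h2, h1, h0⟩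
  trans := by
    intro G H K h k
    obtain ⟨R, h1, h2, h0⟩ := branchingBisimilar_iff.1 h
    obtain ⟨S, k1, k2, k0⟩ := branchingBisimilar_iff.1 k
    refine branchingBisimilar_iff.2 ⟨_, h1.comp k1, ?_, ⟨_, h0, k0⟩⟩
    have := k2.comp h2
    simpa only [and_comm] using this

/-- The setoid of process graphs modulo branching bisimilarity. -/
instance setoid (Act : Type u) : Setoid (ProcessGraph.{u, v} Act) where
  r := BranchingBisimilar
  iseqv := branchingBisimilar_equivalence

end ProcessGraph

/-- A process: a branching bisimilarity equivalence class of process graphs. -/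
def Proc (Act : Type u) : Type (max u (v + 1)) :=
  Quotient (ProcessGraph.setoid.{u, v} Act)

/-- The process of a process graph: its equivalence class. -/
def ProcessGraph.proc {Act : Type u} (G : ProcessGraph.{u, v} Act) : Proc.{u, v} Act :=
  Quotient.mk _ G

/-- The second component of a queue-automaton label `a[x/δ]`: `empty` is `x = ε` (the queue is
required to be empty), `any` is `x = *` (no condition, nothing is dequeued), and `sym d` is `x = d`
(the element `d` at the head of the queue is dequeued). -/
inductive QueueTest (D : Type v) : Type v
  | empty : QueueTest D
  | any : QueueTest D
  | sym (d : D) : QueueTest D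

/-- A queue automaton whose (nonempty, finite) action alphabet consists of elements of `Act`. -/
structure QueueAutomaton (Act : Type u) where
  State : Type v
  Data : Type v
  actions : Finset Act
  state_finite : Finite State
  data_finite : Finite Data
  data_nonempty : Nonempty Data
  actions_nonempty : actions.Nonempty
  /-- `(s, a, x, δ, t) ∈ trans` is the transition `s —a[x/δ]→ t`. -/
  trans : Set (State × Option Act × QueueTest Data × List Data × State)
  trans_finite : trans.Finite
  trans_mem : ∀ s a x δ t, (s, some a, x, δ, t) ∈ trans → a ∈ actions
  init : State
  final : Set State

namespace QueueAutomaton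

variable {Act : Type u}

/-- The transitions between the configurations of a queue automaton. The head of the queue is at
the right end of the list, and new elements are enqueued at the left end. -/
inductive Step (Q : QueueAutomaton.{u, v} Act) :
    Q.State × List Q.Data → Option Act → Q.State × List Q.Data → Prop
  | empty {s t : Q.State} {a : Option Act} {δ : List Q.Data} :
      (s, a, QueueTest.empty, δ, t) ∈ Q.trans → Step Q (s, []) a (t, δ)
  | sym {s t : Q.State} {a : Option Act} {d : Q.Data} {δ : List Q.Data} (ζ : List Q.Data) :
      (s, a, QueueTest.sym d, δ, t) ∈ Q.trans → Step Q (s, ζ ++ [d]) a (t, δ ++ ζ)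
  | any {s t : Q.State} {a : Option Act} {δ : List Q.Data} (ζ : List Q.Data) :
      (s, a, QueueTest.any, δ, t) ∈ Q.trans → Step Q (s, ζ) a (t, δ ++ ζ)

/-- The process graph of a queue automaton. -/
def processGraph (Q : QueueAutomaton.{u, v} Act) : ProcessGraph.{u, v} Act where
  State := Q.State × List Q.Data
  actions := ↑Q.actions
  Step := Q.Step
  step_mem := by
    intro s a t h
    cases h with
    | empty h => exact Q.trans_mem _ _ _ _ _ h
    | sym ζ h => exact Q.trans_mem _ _ _ _ _ h
    | any ζ h => exact Q.trans_mem _ _ _ _ _ h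
  Final := {c | c.1 ∈ Q.final}
  root := (Q.init, [])

/-- The process of a queue automaton. -/
def proc (Q : QueueAutomaton.{u, v} Act) : Proc.{u, v} Act := Q.processGraph.proc

/-- The language accepted by a queue automaton. -/
def language (Q : QueueAutomaton.{u, v} Act) : Language Act := Q.processGraph.language

end QueueAutomaton

/-- A reactive Turing machine whose (nonempty, finite) action alphabet consists of elements of
`Act`. A tape symbol is an element of `Option Data`, where `none` is the blank. -/
structure RTM (Act : Type u) where
  State : Type v
  Data : Type v
  actions : Finset Act
  state_finite : Finite State
  data_finite : Finite Data
  data_nonempty : Nonempty Data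
  actions_nonempty : actions.Nonempty
  /-- `(s, a, d, e, m, t) ∈ trans` is the transition `s —a[d/e]m→ t`. -/
  trans : Set (State × Option Act × Option Data × Option Data × Turing.Dir × State)
  trans_finite : trans.Finite
  trans_mem : ∀ s a d e m t, (s, some a, d, e, m, t) ∈ trans → a ∈ actions
  init : State
  final : Set State

namespace RTM

variable {Act : Type u}

/-- The transitions between the configurations of a reactive Turing machine. An element of
`Turing.Tape (Option Data)` is a two-way infinite tape with a marked cell (the head) and finitely
many nonblank cells, that is, a tape instance up to blanks at its two ends. -/
inductive Step (M : RTM.{u, v} Act) :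
    M.State × Turing.Tape (Option M.Data) → Option Act →
      M.State × Turing.Tape (Option M.Data) → Prop
  | mk {s t : M.State} {a : Option Act} {d e : Option M.Data} {m : Turing.Dir}
      (T : Turing.Tape (Option M.Data)) :
      (s, a, d, e, m, t) ∈ M.trans → T.head = d → Step M (s, T) a (t, (T.write e).move m)

/-- The process graph associated with a reactive Turing machine. -/
def processGraph (M : RTM.{u, v} Act) : ProcessGraph.{u, v} Act where
  State := M.State × Turing.Tape (Option M.Data)
  actions := ↑M.actions
  Step := M.Step
  step_mem := by
    intro s a t h
    cases h with
    | mk T h _ => exact M.trans_mem _ _ _ _ _ _ h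
  Final := {c | c.1 ∈ M.final}
  root := (M.init, Turing.Tape.mk₁ [])

end RTM

/-- A process is executable if it contains the process graph associated with some reactive Turing
machine. -/
def Executable {Act : Type u} (p : Proc.{u, v} Act) : Prop :=
  ∃ M : RTM.{u, v} Act, M.processGraph.proc = p

/-- A language is computable if it is the language of the process graph associated with some
reactive Turing machine. -/
def ComputableLanguage {Act : Type u} (L : Language Act) : Prop :=
  ∃ M : RTM.{u, v} Act, M.processGraph.language = L

end QueueAutomata

/-! Each kind of machine simulates the other. A simulated transition becomes one step with the same
label, followed by finitely many silent steps. Each of these steps is forced: it is the only step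
available and it leaves a nonfinal state. Forced silent steps discard no options, so they are
harmless for branching bisimilarity (`ProcessGraph.branchingBisimilar_of_eventually`). The equality
of languages then follows, because branching bisimilar graphs have the same language.

A queue is kept on a tape as one block of nonblank cells with the head on its right end, where the
queue is read. The machine tests this cell, erases it if it is dequeued, walks left to the first
blank, writes the new elements there and walks back (`branchingBisimilar_toRTM`).

A tape is kept in a queue by holding the scanned symbol in the control state. The queue stores the
left half of the tape (nearest symbol at the back), a separator, and the right half (nearest symbol
at the front). A right move enqueues the written symbol and dequeues the next one. A left move needs
the symbol at the back, so a marker is enqueued and the whole queue is rotated, always holding one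
symbol; when the marker comes out, the held symbol is the wanted one (`eventually_shift`). -/

namespace QueueAutomata

/-! ### Forced silent steps, branching bisimilarity and languages. -/

namespace LTS

variable {Act : Type u}

/-- `T.Eventually N h` : every maximal run from `h` starts with silent steps, each forced and each
leaving a nonfinal state, that lead to a state in `N`. -/
inductive Eventually (T : LTS.{u, v} Act) (N : T.State → Prop) : T.State → Prop
  | base {h : T.State} : N h → Eventually T N h
  | step {h h' : T.State} : T.Step h none h' →
      (∀ a k, T.Step h a k → a = none ∧ k = h') → h ∉ T.Final →
      Eventually T N h' → Eventually T N h

theorem Eventually.exists_steps {T : LTS.{u, v} Act} {N : T.State → Prop} {h : T.State}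
    (H : T.Eventually N h) : ∃ k, T.Steps h [] k ∧ N k := by
  induction H with
  | base h => exact ⟨_, .refl _, h⟩
  | step h1 _ _ _ ih =>
    obtain ⟨k, h2, h3⟩ := ih
    exact ⟨k, .tau h1 h2, h3⟩

/-- Only silent steps may be answered by standing still, so the observable word survives. -/
theorem Transfer.steps_of_word {T U : LTS.{u, v} Act} {R : T.State → U.State → Prop}
    (hR : T.Transfer U R) {s s' : T.State} {w : List Act} (h : T.Steps s w s') :
    ∀ t, R s t → ∃ t', U.Steps t w t' ∧ R s' t' := by
  induction h with
  | refl s => exact fun t ht => ⟨t, .refl _, ht⟩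
  | @act s r _ a w h1 _ ih =>
    intro t ht
    obtain ⟨t', t'', h2, h3, -, h5⟩ := hR.step _ _ ht _ _ h1
    obtain ⟨q, hq, hq'⟩ := ih _ h5
    rcases h3 with h3 | ⟨h3, -⟩
    · exact ⟨q, h2.trans (.act h3 hq), hq'⟩
    · cases h3
  | @tau s r _ w h1 _ ih =>
    intro t ht
    obtain ⟨t', t'', h2, h3, -, h5⟩ := hR.step _ _ ht _ _ h1
    obtain ⟨q, hq, hq'⟩ := ih _ h5
    refine ⟨q, ?_, hq'⟩
    rcases h3 with h3 | ⟨-, rfl⟩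
    · exact h2.trans (.tau h3 hq)
    · exact h2.trans hq

end LTS

namespace ProcessGraph

variable {Act : Type u}

theorem language_le_of_transfer {G H : ProcessGraph.{u, v} Act} {R : G.State → H.State → Prop}
    (hR : G.toLTS.Transfer H.toLTS R) (h0 : R G.root H.root) {w : List Act}
    (hw : w ∈ G.language) : w ∈ H.language := by
  obtain ⟨s, hs, h⟩ := hw
  obtain ⟨t, h1, h2⟩ := hR.steps_of_word h _ h0
  obtain ⟨t', h3, h4⟩ := hR.final _ _ h2 hs
  exact ⟨t', h4, by simpa using h1.trans h3⟩

theorem BranchingBisimilar.language_eq {G H : ProcessGraph.{u, v} Act}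
    (h : G.BranchingBisimilar H) : G.language = H.language := by
  obtain ⟨R, h1, h2, h0⟩ := branchingBisimilar_iff.1 h
  exact Set.ext fun w => ⟨language_le_of_transfer h1 h0, language_le_of_transfer h2 h0⟩

/-- If every step of `G` is matched by a step of `H` between normal forms, up to forced silent
steps of `H`, then `G` and `H` are branching bisimilar. -/
theorem branchingBisimilar_of_eventually {G H : ProcessGraph.{u, v} Act}
    (N : G.State → H.State → Prop)
    (hroot : H.toLTS.Eventually (N G.root) H.root)
    (hfinal : ∀ g h, N g h → (g ∈ G.Final ↔ h ∈ H.Final))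
    (hforth : ∀ g h, N g h → ∀ a g', G.Step g a g' →
      ∃ h', H.Step h a h' ∧ H.toLTS.Eventually (N g') h')
    (hback : ∀ g h, N g h → ∀ a h', H.Step h a h' →
      ∃ g', G.Step g a g' ∧ H.toLTS.Eventually (N g') h') :
    G.BranchingBisimilar H := by
  -- Relate `g` to every state that is forced silently into a normal form of `g`. Before it answers
  -- a step of `g`, such a state first runs to the normal form, which is still related to `g`.
  refine branchingBisimilar_iff.2
    ⟨fun g h => H.toLTS.Eventually (N g) h, ⟨?_, ?_⟩, ⟨?_, ?_⟩, hroot⟩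
  · intro g h hR a g' hg
    obtain ⟨k, hk, hN⟩ := hR.exists_steps
    obtain ⟨k', h1, h2⟩ := hforth _ _ hN _ _ hg
    exact ⟨k', k, hk, Or.inl h1, .base hN, h2⟩
  · intro g h hR hg
    obtain ⟨k, hk, hN⟩ := hR.exists_steps
    exact ⟨k, hk, (hfinal _ _ hN).1 hg⟩
  · intro h g hR a h' hh
    cases hR with
    | base hN =>
      obtain ⟨g', h1, h2⟩ := hback _ _ hN _ _ hh
      exact ⟨g', g, .refl _, Or.inl h1, .base hN, h2⟩
    | step h1 h2 h3 h4 =>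
      -- The step is the forced one; `g` answers by standing still.
      obtain ⟨rfl, rfl⟩ := h2 _ _ hh
      exact ⟨g, g, .refl _, Or.inr ⟨rfl, rfl⟩, .step h1 h2 h3 h4, h4⟩
  · intro h g hR hh
    cases hR with
    | base hN => exact ⟨g, .refl _, (hfinal _ _ hN).2 hh⟩
    | step h1 h2 h3 h4 => exact absurd hh h3

end ProcessGraph

/-- `Act` may be infinite, but the labels that occur lie in `A` together with `τ`. -/
theorem finite_setOf_label_mem {Act : Type*} {α β : Type*} [Finite α] [Finite β]
    (A : Finset Act) (P : α → Option Act → β → Prop)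
    (h : ∀ x a y, P x (some a) y → a ∈ A) :
    {p : α × Option Act × β | P p.1 p.2.1 p.2.2}.Finite := by
  have hA : (insert none (some '' (A : Set Act))).Finite := (A.finite_toSet.image _).insert _
  refine (Set.finite_univ.prod (hA.prod Set.finite_univ)).subset ?_
  rintro ⟨x, a, y⟩ hp
  refine ⟨trivial, ?_, trivial⟩
  cases a with
  | none => exact Or.inl rfl
  | some a => exact Or.inr ⟨a, h _ _ _ hp, rfl⟩

theorem listBlank_mk_default {Γ : Type*} [Inhabited Γ] :
    Turing.ListBlank.mk [(default : Γ)] = Turing.ListBlank.mk [] := by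
  simpa using Turing.ListBlank.cons_head_tail (Turing.ListBlank.mk ([] : List Γ))

end QueueAutomata
namespace QueueAutomata

open Turing

/-! ### From queue automata to reactive Turing machines -/

/-- The control states of the reactive Turing machine simulating a queue automaton: `main s` scans
the head of the queue, `left δ t` walks to the back of the queue to write `δ` there, and `right t`
walks back to the head of the queue. -/
inductive QueueTMState (S D : Type v) (K : ℕ) : Type v
  | main (s : S)
  | left (δ : {l : List D // l.length ≤ K}) (t : S)
  | right (t : S)

instance QueueTMState.finite (S D : Type v) (K : ℕ) [Finite S] [Finite D] :
    Finite (QueueTMState S D K) := by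
  have : Finite {l : List D // l.length ≤ K} := List.finite_length_le D K
  let f : QueueTMState S D K → S ⊕ ({l : List D // l.length ≤ K} × S) ⊕ S
    | .main s => Sum.inl s
    | .left δ t => Sum.inr (Sum.inl (δ, t))
    | .right t => Sum.inr (Sum.inr t)
  refine Finite.of_injective f ?_
  rintro (s | ⟨δ, t⟩ | t) (s' | ⟨δ', t'⟩ | t') h <;> simp_all [f]

namespace QueueAutomaton

variable {Act : Type u} (Q : QueueAutomaton.{u, v} Act) (K : ℕ)

/-- The transitions of the reactive Turing machine simulating a queue automaton. -/
inductive TMTrans : QueueTMState Q.State Q.Data K → Option Act → Option Q.Data → Option Q.Data →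
    Dir → QueueTMState Q.State Q.Data K → Prop
  | sym {s t : Q.State} {a : Option Act} {x : Q.Data} {δ : List Q.Data}
      (h : (s, a, QueueTest.sym x, δ, t) ∈ Q.trans) (hδ : δ.reverse.length ≤ K) :
      TMTrans (.main s) a (some x) none .left (.left ⟨δ.reverse, hδ⟩ t)
  | empty {s t : Q.State} {a : Option Act} {δ : List Q.Data}
      (h : (s, a, QueueTest.empty, δ, t) ∈ Q.trans) (hδ : δ.reverse.length ≤ K) :
      TMTrans (.main s) a none none .left (.left ⟨δ.reverse, hδ⟩ t)
  | any {s t : Q.State} {a : Option Act} {δ : List Q.Data} (d : Option Q.Data)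
      (h : (s, a, QueueTest.any, δ, t) ∈ Q.trans) (hδ : δ.reverse.length ≤ K) :
      TMTrans (.main s) a d d .left (.left ⟨δ.reverse, hδ⟩ t)
  | goLeft (δ : {l : List Q.Data // l.length ≤ K}) (t : Q.State) (x : Q.Data) :
      TMTrans (.left δ t) none (some x) (some x) .left (.left δ t)
  | write (d : Q.Data) (δ : List Q.Data) (h : (d :: δ).length ≤ K) (t : Q.State) :
      TMTrans (.left ⟨d :: δ, h⟩ t) none none (some d) .left
        (.left ⟨δ, (Nat.le_succ _).trans h⟩ t)
  | turn (h : ([] : List Q.Data).length ≤ K) (t : Q.State) :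
      TMTrans (.left ⟨[], h⟩ t) none none none .right (.right t)
  | goRight (t : Q.State) (x : Q.Data) :
      TMTrans (.right t) none (some x) (some x) .right (.right t)
  | arrive (t : Q.State) : TMTrans (.right t) none none none .left (.main t)

/-- The reactive Turing machine simulating a queue automaton whose transitions enqueue at most `K`
elements at a time. -/
@[reducible]
def toRTM : RTM.{u, v} Act where
  State := QueueTMState Q.State Q.Data K
  Data := Q.Data
  actions := Q.actions
  state_finite :=
    have := Q.state_finite
    have := Q.data_finite
    inferInstance
  data_finite := Q.data_finite
  data_nonempty := Q.data_nonempty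
  actions_nonempty := Q.actions_nonempty
  trans := {p | Q.TMTrans K p.1 p.2.1 p.2.2.1 p.2.2.2.1 p.2.2.2.2.1 p.2.2.2.2.2}
  trans_finite := by
    have := Q.state_finite
    have := Q.data_finite
    have : Finite Dir := Finite.of_injective (fun d => (d == Dir.left : Bool)) (by
      rintro (_ | _) (_ | _) h <;> simp_all)
    refine finite_setOf_label_mem Q.actions
      (fun s a (y : Option Q.Data × Option Q.Data × Dir × QueueTMState Q.State Q.Data K) =>
        Q.TMTrans K s a y.1 y.2.1 y.2.2.1 y.2.2.2) ?_
    rintro x a ⟨_, _, _, _⟩ h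
    cases h with
    | sym h _ => exact Q.trans_mem _ _ _ _ _ h
    | empty h _ => exact Q.trans_mem _ _ _ _ _ h
    | any _ h _ => exact Q.trans_mem _ _ _ _ _ h
  trans_mem := by
    intro s a d e m t h
    cases h with
    | sym h _ => exact Q.trans_mem _ _ _ _ _ h
    | empty h _ => exact Q.trans_mem _ _ _ _ _ h
    | any _ h _ => exact Q.trans_mem _ _ _ _ _ h
  init := .main Q.init
  final := {x | ∃ s ∈ Q.final, x = .main s}

/-- This bound is what lets finitely many control states remember the word still to be written. -/
theorem exists_length_le : ∃ K : ℕ, ∀ s a x δ t, (s, a, x, δ, t) ∈ Q.trans → δ.length ≤ K := by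
  obtain ⟨K, hK⟩ := (Q.trans_finite.image fun p => p.2.2.2.1.length).bddAbove
  exact ⟨K, fun s a x δ t h => hK ⟨_, h, rfl⟩⟩

end QueueAutomaton

/-! ### Tapes carrying one block of nonblank cells. -/

section Tape

variable {D : Type v}

/-- The tape with nonblank segments `A` (reversed) to the left of the head and `B` from the head
onwards. -/
def segmentTape (A B : List D) : Tape (Option D) :=
  Tape.mk' (ListBlank.mk (A.map some)) (ListBlank.mk (B.map some))

theorem segmentTape_cons_move_left (x : D) (A B : List D) :
    (segmentTape (x :: A) B).move .left = segmentTape A (x :: B) := by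
  simp [segmentTape, Tape.move_left_mk']

theorem segmentTape_cons_move_right (x : D) (A B : List D) :
    (segmentTape A (x :: B)).move .right = segmentTape (x :: A) B := by
  simp [segmentTape, Tape.move_right_mk']

theorem segmentTape_head_cons (x : D) (A B : List D) :
    (segmentTape A (x :: B)).head = some x := by
  simp [segmentTape]

theorem segmentTape_head_nil (A : List D) : (segmentTape A []).head = none := rfl

theorem segmentTape_nil_move_left_head (B : List D) :
    ((segmentTape [] B).move .left).head = none := rfl

theorem segmentTape_nil_move_left_write (d : D) (B : List D) :
    (((segmentTape [] B).move .left).write (some d)) = segmentTape [] (d :: B) := by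
  simp [segmentTape, Tape.move_left_mk', Tape.write_mk']

/-- A blank at the end of a half tape is invisible, so erasing the last cell shortens the block. -/
theorem segmentTape_singleton_write_none (x : D) (A : List D) :
    (segmentTape A [x]).write none = segmentTape A [] := by
  have h := listBlank_mk_default (Γ := Option D)
  simp only [segmentTape, List.map_cons, List.map_nil, ← ListBlank.cons_mk, Tape.write_mk'] at h ⊢
  exact congrArg (Tape.mk' _) h

theorem segmentTape_nil_nil_move_left :
    (segmentTape ([] : List D) []).move .left = segmentTape [] [] := by
  have h := listBlank_mk_default (Γ := Option D)
  simpa [segmentTape, Tape.move_left_mk'] using congrArg (Tape.mk' _) h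

theorem write_eq_self_of_head {Γ : Type*} [Inhabited Γ] {T : Tape Γ} {d : Γ} (h : T.head = d) :
    T.write d = T := by
  subst h
  exact T.write_self

end Tape

/-! ### Correctness of the simulation of a queue on a tape. -/

namespace QueueAutomaton

variable {Act : Type u} (Q : QueueAutomaton.{u, v} Act) (K : ℕ)

/-- The configuration of the simulating machine that represents a configuration of the queue
automaton. -/
def tmConfig (c : Q.State × List Q.Data) : (Q.toRTM K).processGraph.State :=
  (QueueTMState.main c.1, (segmentTape c.2.reverse []).move .left)

theorem step_toRTM {K : ℕ} {x y : QueueTMState Q.State Q.Data K} {a : Option Act}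
    {d e : Option Q.Data} {m : Dir} {T T' : Tape (Option Q.Data)}
    (h : Q.TMTrans K x a d e m y) (hd : T.head = d) (hT : (T.write e).move m = T') :
    (Q.toRTM K).Step (x, T) a (y, T') := by
  subst hT
  exact RTM.Step.mk (M := Q.toRTM K) T h hd

theorem exists_of_step_toRTM {K : ℕ} {x : QueueTMState Q.State Q.Data K} {a : Option Act}
    {T : Tape (Option Q.Data)} {k : QueueTMState Q.State Q.Data K × Tape (Option Q.Data)}
    (h : (Q.toRTM K).Step (x, T) a k) :
    ∃ d e m y, Q.TMTrans K x a d e m y ∧ T.head = d ∧ k = (y, (T.write e).move m) := by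
  cases h with
  | mk _ h hd => exact ⟨_, _, _, _, h, hd, rfl⟩

/-- Here `hu` expresses that control state and scanned symbol determine the step, and `hx` makes the
state nonfinal. -/
theorem eventually_toRTM_of_trans {K : ℕ} {N : (Q.toRTM K).processGraph.State → Prop}
    {x y : QueueTMState Q.State Q.Data K} {d e : Option Q.Data} {m : Dir}
    {T T' : Tape (Option Q.Data)} (h : Q.TMTrans K x none d e m y) (hd : T.head = d)
    (hT : (T.write e).move m = T') (hx : ∀ s, x ≠ .main s)
    (hu : ∀ a e' m' y', Q.TMTrans K x a d e' m' y' → a = none ∧ e' = e ∧ m' = m ∧ y' = y)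
    (ih : (Q.toRTM K).processGraph.Eventually N (y, T')) :
    (Q.toRTM K).processGraph.Eventually N (x, T) := by
  refine .step (h' := (y, T')) (Q.step_toRTM h hd hT) ?_ ?_ ih
  · intro a k hk
    obtain ⟨d', e', m', y', h1, rfl, rfl⟩ := Q.exists_of_step_toRTM hk
    subst hd
    obtain ⟨rfl, rfl, rfl, rfl⟩ := hu _ _ _ _ h1
    exact ⟨rfl, by rw [hT]⟩
  · rintro ⟨s, -, h⟩
    exact hx s h

/-- Data are never blank, so the walk stops exactly one cell past the block, and the last step left
lands on the head of the queue. -/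
theorem eventually_right (t : Q.State) (B A : List Q.Data) :
    (Q.toRTM K).processGraph.Eventually (· = Q.tmConfig K (t, A.reverse ++ B))
      (QueueTMState.right t, segmentTape A B) := by
  induction B generalizing A with
  | nil =>
    have hT := segmentTape_head_nil A
    refine Q.eventually_toRTM_of_trans (.arrive t) hT (by rw [write_eq_self_of_head hT]) nofun ?_
      (.base (by simp [tmConfig]; rfl))
    intro a e m y h
    cases h
    simp
  | cons x B ih =>
    have hT := segmentTape_head_cons x A B
    refine Q.eventually_toRTM_of_trans (.goRight t x) hT
      (by rw [write_eq_self_of_head hT, segmentTape_cons_move_right]) nofun ?_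
      (by simpa using ih (x :: A))
    intro a e m y h
    cases h
    simp

/-- Writing proceeds from right to left, which reverses the pending word; this is why the control
state stores `δ.reverse`. -/
theorem eventually_write (t : Q.State) (δ : List Q.Data) (hδ : δ.length ≤ K) (B : List Q.Data) :
    (Q.toRTM K).processGraph.Eventually (· = Q.tmConfig K (t, δ.reverse ++ B))
      (QueueTMState.left ⟨δ, hδ⟩ t, (segmentTape [] B).move .left) := by
  have hT := segmentTape_nil_move_left_head B
  induction δ generalizing B with
  | nil =>
    refine Q.eventually_toRTM_of_trans (.turn hδ t) hT
      (by rw [write_eq_self_of_head hT, Tape.move_left_right]) nofun ?_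
      (Q.eventually_right K t B [])
    intro a e m y h
    cases h
    simp
  | cons d δ ih =>
    refine Q.eventually_toRTM_of_trans (.write d δ hδ t) hT
      (by rw [segmentTape_nil_move_left_write]) nofun ?_
      (by simpa using ih ((Nat.le_succ _).trans hδ) (d :: B)
            (segmentTape_nil_move_left_head (d :: B)))
    intro a e m y h
    cases h
    simp

theorem eventually_left (t : Q.State) (δ : List Q.Data) (hδ : δ.length ≤ K) (A B : List Q.Data) :
    (Q.toRTM K).processGraph.Eventually (· = Q.tmConfig K (t, δ.reverse ++ (A.reverse ++ B)))
      (QueueTMState.left ⟨δ, hδ⟩ t, (segmentTape A B).move .left) := by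
  induction A generalizing B with
  | nil => exact Q.eventually_write K t δ hδ B
  | cons x A ih =>
    have hT := segmentTape_cons_move_left x A B
    have hd : ((segmentTape (x :: A) B).move .left).head = some x := by
      rw [hT, segmentTape_head_cons]
    refine Q.eventually_toRTM_of_trans (.goLeft ⟨δ, hδ⟩ t x) hd
      (by rw [write_eq_self_of_head hd, hT]) nofun ?_ (by simpa using ih (x :: B))
    intro a e m y h
    cases h
    simp

theorem eventually_left_of_any (t : Q.State) (δ : List Q.Data) (hδ : δ.reverse.length ≤ K)
    (ζ : List Q.Data) :
    (Q.toRTM K).processGraph.Eventually (· = Q.tmConfig K (t, δ ++ ζ))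
      (QueueTMState.left ⟨δ.reverse, hδ⟩ t,
        ((segmentTape ζ.reverse []).move .left).move .left) := by
  cases ζ using List.reverseRecOn with
  | nil =>
    -- With an empty queue the tape is entirely blank and moving the head changes nothing.
    have := Q.eventually_left K t δ.reverse hδ [] []
    simpa [segmentTape_nil_nil_move_left] using this
  | append_singleton ζ x =>
    have := Q.eventually_left K t δ.reverse hδ ζ.reverse [x]
    simpa [segmentTape_cons_move_left] using this

theorem eventually_left_of_sym (t : Q.State) (δ : List Q.Data) (hδ : δ.reverse.length ≤ K)
    (ζ : List Q.Data) (x : Q.Data) :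
    (Q.toRTM K).processGraph.Eventually (· = Q.tmConfig K (t, δ ++ ζ))
      (QueueTMState.left ⟨δ.reverse, hδ⟩ t,
        (((segmentTape (ζ ++ [x]).reverse []).move .left).write none).move .left) := by
  have := Q.eventually_left K t δ.reverse hδ ζ.reverse []
  simpa [segmentTape_cons_move_left, segmentTape_singleton_write_none] using this

/-- Since the scanned cell is blank for the empty queue, that cell alone decides every queue test.
-/
theorem head_tmConfig_append (ζ : List Q.Data) (x : Q.Data) :
    ((segmentTape (ζ ++ [x]).reverse []).move .left).head = some x := by
  simp [segmentTape_cons_move_left, segmentTape_head_cons]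

theorem branchingBisimilar_toRTM
    (hK : ∀ s a x δ t, (s, a, x, δ, t) ∈ Q.trans → δ.length ≤ K) :
    Q.processGraph.BranchingBisimilar (Q.toRTM K).processGraph := by
  have hK' : ∀ {s a x δ t}, (s, a, x, δ, t) ∈ Q.trans → δ.reverse.length ≤ K := fun h => by
    simpa using hK _ _ _ _ _ h
  refine ProcessGraph.branchingBisimilar_of_eventually (fun c k => k = Q.tmConfig K c) ?_ ?_ ?_ ?_
  · refine .base (Prod.ext rfl ?_)
    exact (segmentTape_nil_nil_move_left (D := Q.Data)).symm
  · rintro c _ rfl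
    constructor
    · exact fun h => ⟨_, h, rfl⟩
    · rintro ⟨s, hs, h⟩
      cases h
      exact hs
  · rintro c _ rfl a c' h
    cases h with
    | @empty s t a δ h =>
      have hd := segmentTape_nil_move_left_head ([] : List Q.Data)
      have := Q.eventually_left_of_any K t δ (hK' h) []
      rw [List.append_nil] at this
      exact ⟨_, Q.step_toRTM (.empty h (hK' h)) hd
        (congrArg (Tape.move .left) (write_eq_self_of_head hd)), this⟩
    | @sym s t a d δ ζ h =>
      exact ⟨_, Q.step_toRTM (.sym h (hK' h)) (Q.head_tmConfig_append ζ d) rfl,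
        Q.eventually_left_of_sym K t δ (hK' h) ζ d⟩
    | @any s t a δ ζ h =>
      exact ⟨_, Q.step_toRTM (.any _ h (hK' h)) rfl (by rw [write_eq_self_of_head rfl]),
        Q.eventually_left_of_any K t δ (hK' h) ζ⟩
  · rintro ⟨s, ζ⟩ _ rfl a k hk
    obtain ⟨d, e, m, y, h, hd, rfl⟩ := Q.exists_of_step_toRTM hk
    cases h with
    | @sym s t a x δ h hδ =>
      cases ζ using List.reverseRecOn with
      | nil => exact absurd ((segmentTape_nil_move_left_head []).symm.trans hd) (by simp)
      | append_singleton ζ y =>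
        cases (Q.head_tmConfig_append ζ y).symm.trans hd
        exact ⟨_, Step.sym ζ h, Q.eventually_left_of_sym K t δ hδ ζ _⟩
    | @empty s t a δ h hδ =>
      cases ζ using List.reverseRecOn with
      | nil =>
        have := Q.eventually_left_of_any K t δ hδ []
        rw [List.append_nil] at this
        rw [write_eq_self_of_head hd]
        exact ⟨_, Step.empty h, this⟩
      | append_singleton ζ y =>
        exact absurd ((Q.head_tmConfig_append ζ y).symm.trans hd) (by simp)
    | @any s t a δ d h hδ =>
      rw [write_eq_self_of_head hd]
      exact ⟨_, Step.any ζ h, Q.eventually_left_of_any K t δ hδ ζ⟩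

end QueueAutomaton

end QueueAutomata
namespace QueueAutomata

open Turing

/-! ### From reactive Turing machines to queue automata -/

/-- The control states of the queue automaton simulating a reactive Turing machine. The state
`main s d` remembers the symbol `d` under the head, `fetch t` reads the symbol to the right of the
old head position, and `shift p t` rotates the queue with delay one, holding `p`. -/
inductive TapeQueueState (S D : Type v) : Type v
  | main (s : S) (d : Option D)
  | fetch (t : S)
  | shift (p : Option (Option D)) (t : S)

instance TapeQueueState.finite (S D : Type v) [Finite S] [Finite D] :
    Finite (TapeQueueState S D) := by
  let f : TapeQueueState S D → (S × Option D) ⊕ S ⊕ (Option (Option D) × S)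
    | .main s d => Sum.inl (s, d)
    | .fetch t => Sum.inr (Sum.inl t)
    | .shift p t => Sum.inr (Sum.inr (p, t))
  refine Finite.of_injective f ?_
  rintro (⟨s, d⟩ | t | ⟨p, t⟩) (⟨s', d'⟩ | t' | ⟨p', t'⟩) h <;> simp_all [f]

/-! ### Simulation of a tape in a queue. -/

namespace RTM

variable {Act : Type u} (M : RTM.{u, v} Act)

/-- The transitions of the queue automaton simulating a reactive Turing machine. The queue symbol
`some (some d)` is a tape symbol, `some none` separates the two halves of the tape and `none` marks
the end of a rotation. -/
inductive QueueTrans : TapeQueueState M.State M.Data → Option Act →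
    QueueTest (Option (Option (Option M.Data))) → List (Option (Option (Option M.Data))) →
    TapeQueueState M.State M.Data → Prop
  | moveRight {s t : M.State} {a : Option Act} {d e : Option M.Data}
      (h : (s, a, d, e, Dir.right, t) ∈ M.trans) :
      QueueTrans (.main s d) a .any [some (some e)] (.fetch t)
  | moveLeft {s t : M.State} {a : Option Act} {d e : Option M.Data}
      (h : (s, a, d, e, Dir.left, t) ∈ M.trans) :
      QueueTrans (.main s d) a .any [none] (.shift (some e) t)
  | fetchEmpty (t : M.State) : QueueTrans (.fetch t) none .empty [some none] (.main t none)
  | fetchSymbol (t : M.State) (d : Option M.Data) :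
      QueueTrans (.fetch t) none (.sym (some (some d))) [] (.main t d)
  | fetchSeparator (t : M.State) :
      QueueTrans (.fetch t) none (.sym (some none)) [none, some (some none)] (.shift none t)
  | rotate (p q : Option (Option M.Data)) (t : M.State) :
      QueueTrans (.shift p t) none (.sym (some q)) [some p] (.shift q t)
  | stopSymbol (d : Option M.Data) (t : M.State) :
      QueueTrans (.shift (some d) t) none (.sym none) [] (.main t d)
  | stopSeparator (t : M.State) :
      QueueTrans (.shift none t) none (.sym none) [some none] (.main t none)

theorem QueueTrans.label_mem {M : RTM.{u, v} Act} {x y : TapeQueueState M.State M.Data} {a : Act}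
    {q : QueueTest (Option (Option (Option M.Data)))} {δ : List (Option (Option (Option M.Data)))}
    (h : M.QueueTrans x (some a) q δ y) : a ∈ M.actions := by
  cases h with
  | moveRight h => exact M.trans_mem _ _ _ _ _ _ h
  | moveLeft h => exact M.trans_mem _ _ _ _ _ _ h

theorem QueueTrans.length_le {M : RTM.{u, v} Act} {x y : TapeQueueState M.State M.Data}
    {a : Option Act} {q : QueueTest (Option (Option (Option M.Data)))}
    {δ : List (Option (Option (Option M.Data)))}
    (h : M.QueueTrans x a q δ y) : δ.length ≤ 2 := by
  cases h <;> simp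

/-- The queue automaton simulating a reactive Turing machine. -/
@[reducible]
def toQueueAutomaton : QueueAutomaton.{u, v} Act where
  State := TapeQueueState M.State M.Data
  Data := Option (Option (Option M.Data))
  actions := M.actions
  state_finite :=
    have := M.state_finite
    have := M.data_finite
    inferInstance
  data_finite :=
    have := M.data_finite
    inferInstance
  data_nonempty := inferInstance
  actions_nonempty := M.actions_nonempty
  trans := {p | M.QueueTrans p.1 p.2.1 p.2.2.1 p.2.2.2.1 p.2.2.2.2}
  trans_finite := by
    have := M.state_finite
    have := M.data_finite
    let D := Option (Option (Option M.Data))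
    have : Finite {l : List D // l.length ≤ 2} := List.finite_length_le D 2
    have : Finite (QueueTest D) := by
      let f : QueueTest D → Option (Option D)
        | .empty => none
        | .any => some none
        | .sym d => some (some d)
      refine Finite.of_injective f ?_
      rintro (_ | _ | d) (_ | _ | d') h <;> simp_all [f]
    -- Words over the queue alphabet form an infinite type; those enqueued have length at most two.
    refine ((finite_setOf_label_mem M.actions
      (fun s a (y : QueueTest D × {l : List D // l.length ≤ 2} × TapeQueueState M.State M.Data) =>
        M.QueueTrans s a y.1 y.2.1 y.2.2) ?_).image
        (fun p => (p.1, p.2.1, p.2.2.1, p.2.2.2.1.1, p.2.2.2.2))).subset ?_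
    · exact fun _ _ _ h => h.label_mem
    · rintro ⟨s, a, x, δ, t⟩ h
      exact ⟨(s, a, x, ⟨δ, QueueTrans.length_le h⟩, t), h, rfl⟩
  trans_mem := fun _ _ _ _ _ h => QueueTrans.label_mem h
  init := .fetch M.init
  final := {x | ∃ s ∈ M.final, ∃ d, x = .main s d}

/-- The queue automaton configuration with control state `s`, head symbol `d`, tape half `l` to the
left of the head (closest symbol first) and tape half `r` to its right. -/
def queueConfig (s : M.State) (l : List (Option M.Data)) (d : Option M.Data)
    (r : List (Option M.Data)) :
    TapeQueueState M.State M.Data × List (Option (Option (Option M.Data))) :=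
  (.main s d, (l.map some ++ none :: (r.map some).reverse).map some)

/-- The tape with head symbol `d`, tape half `l` to the left of the head (closest symbol first) and
tape half `r` to its right. -/
def halvesTape (l : List (Option M.Data)) (d : Option M.Data) (r : List (Option M.Data)) :
    Tape (Option M.Data) :=
  Tape.mk' (ListBlank.mk l) (ListBlank.mk (d :: r))

/-- A configuration of the queue automaton represents a configuration of the machine. -/
def Represents (c : M.State × Tape (Option M.Data))
    (k : TapeQueueState M.State M.Data × List (Option (Option (Option M.Data)))) : Prop :=
  ∃ l d r, c.2 = M.halvesTape l d r ∧ k = M.queueConfig c.1 l d r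

/-- A nonempty queue disables the `empty` test, so `hu` and `hany` suffice to force the step. -/
theorem eventually_sym {N : M.toQueueAutomaton.processGraph.State → Prop}
    {x y : TapeQueueState M.State M.Data} {ζ δ : List (Option (Option (Option M.Data)))}
    {q : Option (Option (Option M.Data))}
    (h : M.QueueTrans x none (.sym q) δ y) (hx : ∀ s d, x ≠ .main s d)
    (hu : ∀ a δ' y', M.QueueTrans x a (.sym q) δ' y' → a = none ∧ δ' = δ ∧ y' = y)
    (hany : ∀ a δ' y', ¬ M.QueueTrans x a .any δ' y')
    (ih : M.toQueueAutomaton.processGraph.Eventually N (y, δ ++ ζ)) :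
    M.toQueueAutomaton.processGraph.Eventually N (x, ζ ++ [q]) := by
  refine .step (h' := (y, δ ++ ζ))
    (QueueAutomaton.Step.sym (Q := M.toQueueAutomaton) ζ h) ?_ ?_ ih
  · intro a k hk
    change M.toQueueAutomaton.Step (x, ζ ++ [q]) a k at hk
    generalize hw : ζ ++ [q] = w at hk
    cases hk with
    | empty _ => simp at hw
    | sym ζ' h' =>
      obtain ⟨rfl, h2⟩ := List.append_inj' hw rfl
      cases h2
      obtain ⟨rfl, rfl, rfl⟩ := hu _ _ _ h'
      exact ⟨rfl, rfl⟩
    | any ζ' h' => exact absurd h' (hany _ _ _)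
  · rintro ⟨s, -, d, h⟩
    exact hx s d h

/-- The invariant of the rotation is the word `X ++ p :: Y`: `X` is still to be dequeued, `p` is
held, and `Y` has been enqueued again behind the marker. Once `X` is empty, the held symbol is the
first letter `z`. -/
theorem eventually_shift {N : M.toQueueAutomaton.processGraph.State → Prop} {t : M.State}
    {z : Option (Option M.Data)} {Z : List (Option (Option M.Data))}
    (hsym : ∀ d, z = some d →
      M.toQueueAutomaton.processGraph.Eventually N (TapeQueueState.main t d, Z.map some))
    (hsep : z = none → M.toQueueAutomaton.processGraph.Eventually N
      (TapeQueueState.main t none, some none :: Z.map some))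
    (X : List (Option (Option M.Data))) (p : Option (Option M.Data))
    (Y : List (Option (Option M.Data))) (h : X ++ p :: Y = z :: Z) :
    M.toQueueAutomaton.processGraph.Eventually N
      (TapeQueueState.shift p t, Y.map some ++ none :: X.map some) := by
  induction X using List.reverseRecOn generalizing p Y with
  | nil =>
    obtain ⟨rfl, rfl⟩ : p = z ∧ Y = Z := by simpa using h
    cases p with
    | none =>
      refine M.eventually_sym (.stopSeparator t) nofun ?_ nofun (hsep rfl)
      rintro a δ y h
      cases h
      simp
    | some d =>
      refine M.eventually_sym (.stopSymbol d t) nofun ?_ nofun (hsym d rfl)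
      rintro a δ y h
      cases h
      simp
  | append_singleton X x ih =>
    have e : Y.map some ++ none :: (X ++ [x]).map some =
        (Y.map some ++ none :: X.map some) ++ [some x] := by simp
    rw [e]
    refine M.eventually_sym (.rotate p x t) nofun ?_ nofun ?_
    · rintro a δ y h
      cases h
      simp
    · exact ih x (p :: Y) (by simpa using h)

theorem eventually_moveLeft (t : M.State) (l : List (Option M.Data)) (d e : Option M.Data)
    (r : List (Option M.Data)) :
    M.toQueueAutomaton.processGraph.Eventually
      (M.Represents (t, ((M.halvesTape l d r).write e).move .left))
      (TapeQueueState.shift (some e) t, [none] ++ (M.queueConfig t l d r).2) := by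
  have hw : (M.halvesTape l d r).write e = M.halvesTape l e r := by
    simp only [halvesTape, ← ListBlank.cons_mk, Tape.write_mk', ListBlank.tail_cons]
  rw [hw]
  cases l with
  | nil =>
    -- The left half is used up, so the symbol finally held is the separator; it is enqueued again
    -- and the new scanned symbol is blank.
    refine M.eventually_shift (z := none) (Z := ((e :: r).map some).reverse) nofun
      (fun _ => .base ⟨[], none, e :: r, ?_, ?_⟩) _ _ [] (by simp)
    · simp only [halvesTape, ← ListBlank.cons_mk, Tape.move_left_mk']
      rfl
    · simp [queueConfig]
  | cons x l =>
    refine M.eventually_shift (z := some x) (Z := l.map some ++ none :: ((e :: r).map some).reverse)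
      (fun d hd => ?_) nofun _ _ [] (by simp)
    cases hd
    refine .base ⟨l, x, e :: r, ?_, ?_⟩
    · simp only [halvesTape, ← ListBlank.cons_mk, Tape.move_left_mk', ListBlank.head_cons,
        ListBlank.tail_cons]
    · simp [queueConfig]

theorem eventually_moveRight (t : M.State) (l : List (Option M.Data)) (d e : Option M.Data)
    (r : List (Option M.Data)) :
    M.toQueueAutomaton.processGraph.Eventually
      (M.Represents (t, ((M.halvesTape l d r).write e).move .right))
      (TapeQueueState.fetch t, [some (some e)] ++ (M.queueConfig t l d r).2) := by
  have hw : (M.halvesTape l d r).write e = M.halvesTape l e r := by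
    simp only [halvesTape, ← ListBlank.cons_mk, Tape.write_mk', ListBlank.tail_cons]
  rw [hw]
  cases r with
  | nil =>
    have e1 : [some (some e)] ++ (M.queueConfig t l d []).2 =
        ((e :: l).map some).map some ++ [some none] := by simp [queueConfig]
    rw [e1]
    -- The right half is used up and the separator has been dequeued, though it belongs at the
    -- front. A blank and the marker are enqueued and a rotation starts with the separator held: it
    -- returns the separator to the front and ends holding the blank, the new scanned symbol.
    refine M.eventually_sym (.fetchSeparator t) nofun ?_ nofun ?_
    · rintro a δ y h
      cases h
      simp
    refine M.eventually_shift (z := some none) (Z := (e :: l).map some ++ [none])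
      (fun d hd => ?_) nofun (some none :: (e :: l).map some) _ [] (by simp)
    cases hd
    refine .base ⟨e :: l, none, [], ?_, ?_⟩
    · simp only [halvesTape, ← ListBlank.cons_mk, Tape.move_right_mk', ListBlank.head_cons,
        ListBlank.tail_cons]
      exact congrArg (Tape.mk' _) (listBlank_mk_default (Γ := Option M.Data)).symm
    · simp [queueConfig]
  | cons x r =>
    have e1 : [some (some e)] ++ (M.queueConfig t l d (x :: r)).2 =
        (M.queueConfig t (e :: l) x r).2 ++ [some (some x)] := by simp [queueConfig]
    rw [e1]
    refine M.eventually_sym (.fetchSymbol t x) nofun ?_ nofun (.base ⟨e :: l, x, r, ?_, rfl⟩)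
    · rintro a δ y h
      cases h
      simp
    · simp only [halvesTape, ← ListBlank.cons_mk, Tape.move_right_mk', ListBlank.head_cons,
        ListBlank.tail_cons]

theorem branchingBisimilar_toQueueAutomaton :
    M.processGraph.BranchingBisimilar M.toQueueAutomaton.processGraph := by
  refine ProcessGraph.branchingBisimilar_of_eventually M.Represents ?_ ?_ ?_ ?_
  · refine .step (h' := M.queueConfig M.init [] none [])
      (QueueAutomaton.Step.empty (Q := M.toQueueAutomaton) (.fetchEmpty M.init)) ?_ ?_
      (.base ⟨[], none, [], ?_, rfl⟩)
    · intro a k hk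
      change M.toQueueAutomaton.Step (_, []) a k at hk
      generalize hw : ([] : List (Option (Option (Option M.Data)))) = w at hk
      cases hk with
      | empty h =>
        cases h
        exact ⟨rfl, rfl⟩
      | sym ζ h => simp at hw
      | any ζ h => cases h
    · rintro ⟨s, -, d, h⟩
      cases h
    · exact congrArg (Tape.mk' _) (listBlank_mk_default (Γ := Option M.Data)).symm
  · rintro ⟨s, _⟩ _ ⟨l, d, r, rfl, rfl⟩
    constructor
    · exact fun h => ⟨s, h, d, rfl⟩
    · rintro ⟨s, hs, d, h⟩
      cases h
      exact hs
  · rintro ⟨s, _⟩ _ ⟨l, d, r, rfl, rfl⟩ a c' h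
    cases h with
    | @mk _ t _ d' e m _ h hd =>
      -- A tape has many representing pairs of halves, differing by outer blanks, but they all agree
      -- on the scanned symbol.
      have hd' : d = d' := by simpa [halvesTape] using hd
      subst hd'
      cases m with
      | left => exact ⟨_, QueueAutomaton.Step.any (Q := M.toQueueAutomaton) _ (.moveLeft h),
          M.eventually_moveLeft t l d e r⟩
      | right => exact ⟨_, QueueAutomaton.Step.any (Q := M.toQueueAutomaton) _ (.moveRight h),
          M.eventually_moveRight t l d e r⟩
  · rintro ⟨s, _⟩ _ ⟨l, d, r, rfl, rfl⟩ a k hk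
    have hd : (M.halvesTape l d r).head = d := by simp [halvesTape]
    change M.toQueueAutomaton.Step (.main s d, (M.queueConfig s l d r).2) a k at hk
    generalize hw : (M.queueConfig s l d r).2 = w at hk
    cases hk with
    | empty h => cases h
    | sym ζ h => cases h
    | any ζ h =>
      subst hw
      cases h with
      | @moveRight _ t _ _ e h =>
        exact ⟨_, Step.mk _ h hd, M.eventually_moveRight t l d e r⟩
      | @moveLeft _ t _ _ e h =>
        exact ⟨_, Step.mk _ h hd, M.eventually_moveLeft t l d e r⟩

end RTM

end QueueAutomata

theorem mainTheorem2 {Act : Type u} :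
    (∀ p : QueueAutomata.Proc.{u, v} Act,
      QueueAutomata.Executable p ↔
        ∃ Q : QueueAutomata.QueueAutomaton.{u, v} Act, Q.proc = p) ∧
    (∀ L : Language Act,
      QueueAutomata.ComputableLanguage.{u, v} L ↔
        ∃ Q : QueueAutomata.QueueAutomaton.{u, v} Act, Q.language = L) := by
  refine ⟨fun p => ⟨?_, ?_⟩, fun L => ⟨?_, ?_⟩⟩
  · rintro ⟨M, rfl⟩
    exact ⟨M.toQueueAutomaton, (Quotient.sound M.branchingBisimilar_toQueueAutomaton).symm⟩
  · rintro ⟨Q, rfl⟩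
    obtain ⟨K, hK⟩ := Q.exists_length_le
    exact ⟨Q.toRTM K, (Quotient.sound (Q.branchingBisimilar_toRTM K hK)).symm⟩
  · rintro ⟨M, rfl⟩
    exact ⟨M.toQueueAutomaton, M.branchingBisimilar_toQueueAutomaton.language_eq.symm⟩
  · rintro ⟨Q, rfl⟩
    obtain ⟨K, hK⟩ := Q.exists_length_le
    exact ⟨Q.toRTM K, (Q.branchingBisimilar_toRTM K hK).language_eq.symm⟩
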